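/- For $v,w\in\mathbb{R}^2$ write $v\times w=v_1w_2-v_2w_1$. Let $S\subset\mathbb{R}^2$ be a closed and bounded set containing the origin which is star-shaped with respect to the origin, i.e. for every $r\in S$ the segment from $0$ to $r$ lies in $S$. Assume that $S$ has a piecewise smooth, positively oriented boundary: there are finitely many arcs $\gamma_1,\dots,\gamma_n:[0,1]\to\mathbb{R}^2$, each continuously differentiable with nowhere vanishing derivative, such that - $\partial S=\bigcup_i\gamma_i([0,1])$; - the arcs do not overlap: if $\gamma_i(u)=\gamma_j(v)$ with $u\in(0,1)$ and $v\in[0,1]$, then $i=j$ and $u=v$ (so arcs may meet only at end points); - $S$ lies to the left of each arc and its complement to the right: if $N$ denotes $\gamma_i'(u)$ rotated counterclockwise by a right angle, $u\in(0,1)$, then $\gamma_i(u)+\varepsilon N\in S$ and $\gamma_i(u)-\varepsilon N\notin S$ for all sufficiently small $\varepsilon>0$. Let $\rho:S\to\mathbb{R}$ be continuously differentiable on $S$. Then all the integrals below exist, and $$\int_S\rho(r)\,dA=\oint_{\partial S}\left(\int_0^1 t\,\rho(t r)\,dt\right)(r\times\tau)\,ds,$$ where $s$ is arclength and $\tau$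 is the unit tangent vector of $\partial S$, that is, $\oint_{\partial S}f(r,\tau)\,ds=\sum_{i=1}^n\int_0^1 f\bigl(\gamma_i(u),\gamma_i'(u)/|\gamma_i'(u)|\bigr)\,|\gamma_i'(u)|\,du$. -/

import Mathlib

open MeasureTheory Set Filter Topology

/-- The Euclidean plane. -/
abbrev Plane : Type := EuclideanSpace ℝ (Fin 2)

/-- The scalar cross product `v × w = v₁ w₂ - v₂ w₁` of plane vectors. -/
def cross (v w : Plane) : ℝ := v 0 * w 1 - v 1 * w 0

/-- The counterclockwise rotation by a right angle, `(a, b) ↦ (-b, a)`. -/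
def rotLeft (v : Plane) : Plane := !₂[-v 1, v 0]

/-- The velocity of a curve parametrized by `[0, 1]` (one-sided at the end points). -/
noncomputable def velocity (γ : ℝ → Plane) (u : ℝ) : Plane :=
  derivWithin γ (Icc 0 1) u

/-- The unit tangent vector `τ` of a curve parametrized by `[0, 1]`. -/
noncomputable def unitTangent (γ : ℝ → Plane) (u : ℝ) : Plane :=
  ‖velocity γ u‖⁻¹ • velocity γ u

/-- A smooth arc: continuously differentiable on `[0, 1]` with nowhere vanishing velocity. -/
structure IsSmoothArc (γ : ℝ → Plane) : Prop where
  contDiffOn : ContDiffOn ℝ 1 γ (Icc 0 1)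
  velocity_ne_zero : ∀ u ∈ Icc (0 : ℝ) 1, velocity γ u ≠ 0

/-- The arcs `γ 0, …, γ (n - 1)` exhibit the boundary of `S` as piecewise smooth and orient it
positively: they are smooth arcs which together trace out exactly the boundary, they do not overlap
(an interior point of an arc is passed only once; arcs may share end points, and the two end points
of one arc may coincide), and `S` lies to the left of each arc and its complement to the right. -/
structure IsPiecewiseSmoothBoundary (S : Set Plane) {n : ℕ} (γ : Fin n → ℝ → Plane) : Prop where
  smooth : ∀ i, IsSmoothArc (γ i)
  cover : ⋃ i, γ i '' Icc 0 1 = frontier S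
  nonoverlap : ∀ i j, ∀ u ∈ Ioo (0 : ℝ) 1, ∀ v ∈ Icc (0 : ℝ) 1,
    γ i u = γ j v → i = j ∧ u = v
  left_mem : ∀ i, ∀ u ∈ Ioo (0 : ℝ) 1,
    ∀ᶠ ε : ℝ in 𝓝[>] 0, γ i u + ε • rotLeft (velocity (γ i) u) ∈ S
  right_notMem : ∀ i, ∀ u ∈ Ioo (0 : ℝ) 1,
    ∀ᶠ ε : ℝ in 𝓝[>] 0, γ i u - ε • rotLeft (velocity (γ i) u) ∉ S

/-- The pull-back to `[0, 1]` of `f(r, τ) ds`, where `ds = ‖γ'(u)‖ du`. -/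
noncomputable def arcIntegrand (f : Plane → Plane → ℝ) (γ : ℝ → Plane) (u : ℝ) : ℝ :=
  f (γ u) (unitTangent γ u) * ‖velocity γ u‖

/-- The boundary integral `∮ f(r, τ) ds` with respect to arclength over finitely many arcs. -/
noncomputable def boundaryIntegral {n : ℕ} (γ : Fin n → ℝ → Plane)
    (f : Plane → Plane → ℝ) : ℝ :=
  ∑ i, ∫ u in (0 : ℝ)..1, arcIntegrand f (γ i) u

/-- The dilation integral `∫₀¹ t ρ(t r) dt`. -/
noncomputable def dilationIntegral (ρ : Plane → ℝ) (r : Plane) : ℝ :=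
  ∫ t in (0 : ℝ)..1, t * ρ (t • r)

/-! The plane is parametrized by the cone maps `(t, u) ↦ t γᵢ(u)`, whose Jacobian is `t (γᵢ × γᵢ')`.
Star-shapedness and orientation force `γᵢ × γᵢ' ≥ 0` (`cross_nonneg`): otherwise points just to the
right of the arc would lie on radii of `S`. Where the cross product is positive, the cone map is
locally open, so `t γᵢ(u)` is interior for `0 < t < 1` (`smul_mem_interior`). A radius therefore
meets the boundary only at `t = 1` (apart possibly from `t = 0`), and non-overlap makes the
parametrization injective across all arcs (`coneMap_injective`). Where the cross product vanishes,
the image is null by Sard's theorem.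

Thus `S` is, up to a null set, a disjoint union of injective images. Change of variables and Fubini,
with `t` as the inner variable, give the formula, because `(r × τ) ds = (γ × γ') du`. -/

/-- The cone over a curve, as a map of the plane: `(t, u) ↦ t γ(u)`. -/
noncomputable def coneMap (γ : ℝ → Plane) (p : Plane) : Plane := p 0 • γ (p 1)

/-- The linear map `w ↦ w₀ x + w₁ y`. -/
noncomputable def columnMap (x y : Plane) : Plane →L[ℝ] Plane :=
  (EuclideanSpace.proj (0 : Fin 2) : Plane →L[ℝ] ℝ).smulRight x +
    (EuclideanSpace.proj (1 : Fin 2) : Plane →L[ℝ] ℝ).smulRight y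

theorem columnMap_apply (x y w : Plane) : columnMap x y w = w 0 • x + w 1 • y := by
  simp [columnMap]

theorem det_columnMap (x y : Plane) : (columnMap x y).det = cross x y := by
  rw [ContinuousLinearMap.det,
    ← LinearMap.det_toMatrix (EuclideanSpace.basisFun (Fin 2) ℝ).toBasis, Matrix.det_fin_two]
  simp [LinearMap.toMatrix_apply, columnMap_apply, cross]
  ring

theorem hasStrictFDerivAt_coneMap {γ : ℝ → Plane} {v : Plane} {p : Plane}
    (h : HasStrictDerivAt γ v (p 1)) :
    HasStrictFDerivAt (coneMap γ) (columnMap (γ (p 1)) (p 0 • v)) p := by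
  have h0 : HasStrictFDerivAt (fun p : Plane => p 0)
      (EuclideanSpace.proj (0 : Fin 2) : Plane →L[ℝ] ℝ) p :=
    (EuclideanSpace.proj (0 : Fin 2) : Plane →L[ℝ] ℝ).hasStrictFDerivAt
  have h1 : HasStrictFDerivAt (fun p : Plane => p 1)
      (EuclideanSpace.proj (1 : Fin 2) : Plane →L[ℝ] ℝ) p :=
    (EuclideanSpace.proj (1 : Fin 2) : Plane →L[ℝ] ℝ).hasStrictFDerivAt
  have h2 := h0.smul (h.hasStrictFDerivAt.comp p h1)
  refine h2.congr_fderiv ?_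
  ext w : 1
  simp [columnMap_apply, smul_smul, mul_comm]
  abel

theorem IsSmoothArc.hasStrictDerivAt {γ : ℝ → Plane} (h : IsSmoothArc γ) {u : ℝ}
    (hu : u ∈ Ioo (0 : ℝ) 1) : HasStrictDerivAt γ (velocity γ u) u := by
  have hn : Icc (0 : ℝ) 1 ∈ 𝓝 u := Icc_mem_nhds hu.1 hu.2
  have h1 := (h.contDiffOn.contDiffAt hn).hasStrictDerivAt one_ne_zero
  rwa [velocity, derivWithin_of_mem_nhds hn]

theorem IsSmoothArc.continuousOn_velocity {γ : ℝ → Plane} (h : IsSmoothArc γ) :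
    ContinuousOn (velocity γ) (Icc 0 1) :=
  h.contDiffOn.continuousOn_derivWithin (uniqueDiffOn_Icc zero_lt_one) le_rfl

theorem ContinuousOn.cross {X : Type*} [TopologicalSpace X] {f g : X → Plane} {s : Set X}
    (hf : ContinuousOn f s) (hg : ContinuousOn g s) :
    ContinuousOn (fun x => cross (f x) (g x)) s := by
  unfold _root_.cross
  fun_prop

theorem cross_smul_right (x y : Plane) (c : ℝ) : cross x (c • y) = c * cross x y := by
  simp [cross]; ring

/-- The speed in `ds` cancels the normalization of `τ`. -/
theorem arcIntegrand_dilation_eq {γ : ℝ → Plane} (h : IsSmoothArc γ) (f : Plane → ℝ) {u : ℝ}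
    (hu : u ∈ Icc (0 : ℝ) 1) :
    arcIntegrand (fun r τ => f r * cross r τ) γ u = f (γ u) * cross (γ u) (velocity γ u) := by
  have := norm_ne_zero_iff.2 (h.velocity_ne_zero u hu)
  simp only [arcIntegrand, unitTangent, cross_smul_right]
  field_simp

/-- Near a parameter where the curve is transverse to the radial direction, the cone map is a
local homeomorphism. -/
theorem map_nhds_coneMap {γ : ℝ → Plane} {v : Plane} {p : Plane}
    (h : HasStrictDerivAt γ v (p 1)) (hp : p 0 ≠ 0) (hv : cross (γ (p 1)) v ≠ 0) :
    map (coneMap γ) (𝓝 p) = 𝓝 (coneMap γ p) := by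
  have hd : (columnMap (γ (p 1)) (p 0 • v)).det ≠ 0 := by
    rw [det_columnMap, cross_smul_right]; exact mul_ne_zero hp hv
  have hs := hasStrictFDerivAt_coneMap h
  rw [← ContinuousLinearMap.coe_toContinuousLinearEquivOfDetNeZero _ hd] at hs
  exact hs.map_nhds_eq_of_equiv

/-! ### Orientation and interior points of the cones -/

section boundary
variable {S : Set Plane} {n : ℕ} {γ : Fin n → ℝ → Plane}

theorem IsPiecewiseSmoothBoundary.mem_frontier (hγ : IsPiecewiseSmoothBoundary S γ) (i : Fin n)
    {u : ℝ} (hu : u ∈ Icc (0 : ℝ) 1) : γ i u ∈ frontier S := by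
  rw [← hγ.cover]
  exact mem_iUnion.2 ⟨i, u, hu, rfl⟩

theorem IsPiecewiseSmoothBoundary.coneMap_mem (hγ : IsPiecewiseSmoothBoundary S γ)
    (hclosed : IsClosed S) (hstar : StarConvex ℝ (0 : Plane) S) (i : Fin n) {p : Plane}
    (h0 : p 0 ∈ Icc (0 : ℝ) 1) (h1 : p 1 ∈ Icc (0 : ℝ) 1) : coneMap (γ i) p ∈ S :=
  hstar.smul_mem (hclosed.frontier_subset (hγ.mem_frontier i h1)) h0.1 h0.2

/-- Points strictly inside the cone over a transverse boundary point are interior points. -/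
theorem IsPiecewiseSmoothBoundary.smul_mem_interior (hγ : IsPiecewiseSmoothBoundary S γ)
    (hclosed : IsClosed S) (hstar : StarConvex ℝ (0 : Plane) S) (i : Fin n) {t u : ℝ}
    (ht : t ∈ Ioo (0 : ℝ) 1) (hu : u ∈ Ioo (0 : ℝ) 1)
    (hc : cross (γ i u) (velocity (γ i) u) ≠ 0) : t • γ i u ∈ interior S := by
  have hm := map_nhds_coneMap (p := !₂[t, u]) (γ := γ i) (v := velocity (γ i) u)
    (by simpa using (hγ.smooth i).hasStrictDerivAt hu) (by simpa using ht.1.ne') (by simpa using hc)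
  have e : coneMap (γ i) !₂[t, u] = t • γ i u := by simp [coneMap]
  -- By local openness it suffices that parameters near `(t, u)` are sent into `S`; they stay in the
  -- unit square.
  rw [mem_interior_iff_mem_nhds, ← e, ← hm, mem_map]
  have c0 : ContinuousAt (fun p : Plane => p 0) !₂[t, u] := by fun_prop
  have c1 : ContinuousAt (fun p : Plane => p 1) !₂[t, u] := by fun_prop
  filter_upwards [c0.eventually_mem (Icc_mem_nhds (by simpa using ht.1) (by simpa using ht.2)),
    c1.eventually_mem (Icc_mem_nhds (by simpa using hu.1) (by simpa using hu.2))] with p h0 h1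
  exact hγ.coneMap_mem hclosed hstar i h0 h1

/-- The boundary of a star-shaped set runs counterclockwise around the center. -/
theorem IsPiecewiseSmoothBoundary.cross_nonneg (hγ : IsPiecewiseSmoothBoundary S γ)
    (hclosed : IsClosed S) (hstar : StarConvex ℝ (0 : Plane) S) (i : Fin n) {u : ℝ}
    (hu : u ∈ Ioo (0 : ℝ) 1) : 0 ≤ cross (γ i u) (velocity (γ i) u) := by
  by_contra! hc
  set v := velocity (γ i) u with hv
  -- The boundary point has cone parameters `(1, u)`; the local inverse `g` recovers the parameters
  -- of nearby points.
  set q : Plane := !₂[1, u] with hq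
  have q0 : q 0 = 1 := by simp [hq]
  have q1 : q 1 = u := by simp [hq]
  have hs := hasStrictFDerivAt_coneMap (p := q) (γ := γ i) (v := v)
    (by rw [q1]; exact (hγ.smooth i).hasStrictDerivAt hu)
  rw [q0, q1, one_smul] at hs
  have hd : (columnMap (γ i u) v).det ≠ 0 := by rw [det_columnMap]; exact hc.ne
  have hL := ContinuousLinearMap.coe_toContinuousLinearEquivOfDetNeZero _ hd
  set L := (columnMap (γ i u) v).toContinuousLinearEquivOfDetNeZero hd
  rw [← hL] at hs
  have hinv := hs.to_localInverse.hasFDerivAt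
  have hright := hs.eventually_right_inverse
  have hcont := hs.localInverse_continuousAt
  have himg := hs.localInverse_apply_image
  set g := hs.localInverse
  have e : coneMap (γ i) q = γ i u := by simp [coneMap, hq]
  rw [e] at hinv hright hcont himg
  set N := rotLeft v with hN
  let ℓ : ℝ → Plane := fun ε => γ i u - ε • N
  have hℓ0 : ℓ 0 = γ i u := by simp [ℓ]
  have hℓ : HasDerivAt ℓ (-N) 0 := by
    simpa [ℓ] using ((hasDerivAt_id (0 : ℝ)).smul_const N).const_sub (γ i u)
  have hg : HasDerivAt (fun ε => g (ℓ ε)) (L.symm (-N)) 0 := by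
    rw [← hℓ0] at hinv
    exact hinv.comp_hasDerivAt 0 hℓ
  have hg0 : HasDerivAt (fun ε => g (ℓ ε) 0) (L.symm (-N) 0) 0 :=
    (EuclideanSpace.proj (0 : Fin 2) : Plane →L[ℝ] ℝ).hasFDerivAt.comp_hasDerivAt 0 hg
  -- Crossing `w 0 • γ i u + w 1 • v = -N` with `v` gives `w 0 * (γ i u × v) = |v|²`, so `w 0` has
  -- the sign of the cross product.
  have hneg : L.symm (-N) 0 < 0 := by
    set w := L.symm (-N) with hw
    have h1 : columnMap (γ i u) v w = -N := by
      rw [← hL]; exact L.apply_symm_apply (-N)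
    rw [columnMap_apply] at h1
    have a0 := congrArg (fun z : Plane => z 0) h1
    have a1 := congrArg (fun z : Plane => z 1) h1
    simp [hN, rotLeft] at a0 a1
    have hvne : v ≠ 0 := (hγ.smooth i).velocity_ne_zero u (Ioo_subset_Icc_self hu)
    have hpos : 0 < v 0 ^ 2 + v 1 ^ 2 := by
      by_contra! hle
      apply hvne
      ext k
      fin_cases k <;> simp <;> nlinarith [sq_nonneg (v 0), sq_nonneg (v 1)]
    have key : w 0 * cross (γ i u) v = v 0 ^ 2 + v 1 ^ 2 := by
      simp only [cross]
      linear_combination v 1 * a0 - v 0 * a1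
    by_contra! hge
    nlinarith [mul_nonneg hge (neg_nonneg.2 hc.le)]
  have hlt : ∀ᶠ ε in 𝓝[>] (0 : ℝ), g (ℓ ε) 0 < 1 := by
    have h1 := (hasDerivWithinAt_iff_tendsto_slope' (by simp)).1 (hg0.hasDerivWithinAt (s := Ioi 0))
    filter_upwards [h1.eventually (gt_mem_nhds hneg), self_mem_nhdsWithin] with ε h2 h3
    rw [slope_def_field, hℓ0, himg, q0, sub_zero, div_lt_iff₀ h3] at h2
    linarith
  have hℓc : Tendsto ℓ (𝓝[>] 0) (𝓝 (γ i u)) := by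
    have := hℓ.continuousAt.tendsto
    rw [hℓ0] at this
    exact this.mono_left nhdsWithin_le_nhds
  have hgc : Tendsto (fun ε => g (ℓ ε)) (𝓝[>] 0) (𝓝 q) := by
    have := hcont.tendsto.comp hℓc
    rwa [himg] at this
  have hgk : ∀ k : Fin 2, Tendsto (fun ε => g (ℓ ε) k) (𝓝[>] 0) (𝓝 (q k)) := fun k =>
    ((EuclideanSpace.proj k : Plane →L[ℝ] ℝ).continuous.tendsto q).comp hgc
  -- Moving right lowers the radial parameter below `1`, so these points lie on radii of `S`,
  -- against `right_notMem`.
  have hfalse : ∀ᶠ ε in 𝓝[>] (0 : ℝ), False := by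
    filter_upwards [hlt, hℓc.eventually hright, hγ.right_notMem i u hu,
      (hgk 0).eventually_mem (Ioi_mem_nhds (show (0 : ℝ) < q 0 by simp [q0])),
      (hgk 1).eventually_mem (Icc_mem_nhds (q1 ▸ hu.1) (q1 ▸ hu.2))] with ε h1 h2 h3 h4 h5
    apply h3
    change ℓ ε ∈ S
    rw [← h2]
    exact hγ.coneMap_mem hclosed hstar i ⟨le_of_lt h4, h1.le⟩ h5
  exact hfalse.exists.elim fun _ h => h

end boundary

/-! ### Parameter domains, rays and lines -/

/-- The parameters `(t, u)` with `0 < t ≤ 1` and `0 < u < 1`. -/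
def coneDomain : Set Plane := {p | p 0 ∈ Ioc (0 : ℝ) 1 ∧ p 1 ∈ Ioo (0 : ℝ) 1}

/-- The parameters over which the curve is positively transverse to the radial direction. -/
def transverseDomain (γ : ℝ → Plane) : Set Plane :=
  {p ∈ coneDomain | 0 < cross (γ (p 1)) (velocity γ (p 1))}

theorem measurableSet_coneDomain : MeasurableSet coneDomain := by
  have h0 : Measurable fun p : Plane => p 0 := by fun_prop
  have h1 : Measurable fun p : Plane => p 1 := by fun_prop
  exact (h0 measurableSet_Ioc).inter (h1 measurableSet_Ioo)

theorem IsSmoothArc.measurableSet_transverseDomain {γ : ℝ → Plane} (h : IsSmoothArc γ) :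
    MeasurableSet (transverseDomain γ) := by
  have hc : ContinuousOn (fun u => cross (γ u) (velocity γ u)) (Ioo 0 1) :=
    (h.contDiffOn.continuousOn.cross h.continuousOn_velocity).mono Ioo_subset_Icc_self
  have ho := (hc.isOpen_inter_preimage isOpen_Ioo (isOpen_Ioi (a := (0 : ℝ)))).measurableSet
  have h1 : Measurable fun p : Plane => p 1 := by fun_prop
  convert measurableSet_coneDomain.inter (h1 ho) using 1
  ext p
  simp only [transverseDomain, coneDomain, mem_ofPred_eq, mem_inter_iff, mem_preimage, mem_Ioi]
  tauto

theorem IsSmoothArc.hasFDerivWithinAt_coneMap {γ : ℝ → Plane} (h : IsSmoothArc γ) {s : Set Plane}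
    {p : Plane} (hp : p ∈ coneDomain) :
    HasFDerivWithinAt (coneMap γ) (columnMap (γ (p 1)) (p 0 • velocity γ (p 1))) s p :=
  (hasStrictFDerivAt_coneMap (h.hasStrictDerivAt hp.2)).hasFDerivAt.hasFDerivWithinAt

/-- The last point of a compact set on a ray from the origin is a boundary point. -/
theorem exists_one_le_smul_mem_frontier {S : Set Plane} (hclosed : IsClosed S)
    (hbdd : Bornology.IsBounded S) {x : Plane} (hx : x ∈ S) (hx0 : x ≠ 0) :
    ∃ s : ℝ, 1 ≤ s ∧ s • x ∈ frontier S := by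
  let T : Set ℝ := {s | s • x ∈ S}
  have hTc : IsClosed T := hclosed.preimage (by fun_prop : Continuous fun s : ℝ => s • x)
  obtain ⟨R, hR⟩ := hbdd.exists_norm_le
  have hTb : BddAbove T := by
    refine ⟨R / ‖x‖, fun s hs => ?_⟩
    rw [le_div_iff₀ (norm_pos_iff.2 hx0)]
    calc s * ‖x‖ ≤ |s| * ‖x‖ := by gcongr; exact le_abs_self s
      _ = ‖s • x‖ := by rw [norm_smul, Real.norm_eq_abs]
      _ ≤ R := hR _ hs
  have h1 : (1 : ℝ) ∈ T := by simpa [T] using hx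
  have hm : sSup T ∈ T := hTc.csSup_mem ⟨1, h1⟩ hTb
  -- Were the last point interior, the ray would stay in `S` slightly longer.
  refine ⟨sSup T, le_csSup hTb h1, subset_closure hm, fun hi => ?_⟩
  have hn : ∀ᶠ s in 𝓝 (sSup T), s • x ∈ S :=
    (by fun_prop : ContinuousAt (fun s : ℝ => s • x) (sSup T)).eventually_mem
      (mem_interior_iff_mem_nhds.1 hi)
  obtain ⟨s, hs, hlt⟩ := ((hn.filter_mono nhdsWithin_le_nhds).and
    (self_mem_nhdsWithin : Ioi (sSup T) ∈ 𝓝[>] (sSup T))).exists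
  exact absurd (le_csSup hTb hs) (not_le.2 hlt)

/-- The line lies in the image of a singular linear map. -/
theorem volume_range_smul (v : Plane) : volume (range fun t : ℝ => t • v) = 0 := by
  have h : (range fun t : ℝ => t • v) ⊆ columnMap v 0 '' univ := by
    rintro _ ⟨t, rfl⟩
    exact ⟨!₂[t, 0], mem_univ _, by simp [columnMap_apply]⟩
  refine measure_mono_null h ?_
  have hd : LinearMap.det (columnMap v 0 : Plane →ₗ[ℝ] Plane) = 0 := by
    have := det_columnMap v 0
    rw [ContinuousLinearMap.det] at this
    simp [this, cross]
  rw [Measure.addHaar_image_continuousLinearMap, hd]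
  simp

/-! ### Covering the set by injective cones -/

section boundary
variable {S : Set Plane} {n : ℕ} {γ : Fin n → ℝ → Plane}

/-- Two cone points over transverse boundary points coincide only if their parameters do. -/
theorem IsPiecewiseSmoothBoundary.coneMap_injective (hγ : IsPiecewiseSmoothBoundary S γ)
    (hclosed : IsClosed S) (hstar : StarConvex ℝ (0 : Plane) S) {i j : Fin n} {p q : Plane}
    (hp : p ∈ transverseDomain (γ i)) (hq : q ∈ transverseDomain (γ j))
    (h : coneMap (γ i) p = coneMap (γ j) q) : i = j ∧ p = q := by
  wlog hle : q 0 ≤ p 0 generalizing i j p q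
  · obtain ⟨h1, h2⟩ := this hq hp h.symm (le_of_not_ge hle)
    exact ⟨h1.symm, h2.symm⟩
  have hp0 := hp.1.1.1
  have hq0 := hq.1.1.1
  have e : γ i (p 1) = (q 0 / p 0) • γ j (q 1) := by
    have : (p 0)⁻¹ • p 0 • γ i (p 1) = (p 0)⁻¹ • q 0 • γ j (q 1) := congrArg _ h
    rwa [inv_smul_smul₀ hp0.ne', smul_smul, inv_mul_eq_div] at this
  -- If `q 0 < p 0`, the boundary point `γ i (p 1)` would lie strictly inside a transverse radius,
  -- hence in the interior.
  have h1 : q 0 = p 0 := by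
    by_contra hne
    have hlt : q 0 < p 0 := lt_of_le_of_ne hle hne
    have hi := hγ.smul_mem_interior hclosed hstar j
      ⟨div_pos hq0 hp0, (div_lt_one hp0).2 hlt⟩ hq.1.2 hq.2.ne'
    rw [← e] at hi
    exact (hγ.mem_frontier i (Ioo_subset_Icc_self hp.1.2)).2 hi
  rw [h1, div_self hp0.ne', one_smul] at e
  obtain ⟨hij, hu⟩ := hγ.nonoverlap i j _ hp.1.2 _ (Ioo_subset_Icc_self hq.1.2) e
  refine ⟨hij, ?_⟩
  ext k
  fin_cases k
  · exact h1.symm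
  · exact hu

/-- Up to a null set, a star-shaped set is swept out by the radii to its transverse boundary
points. -/
theorem IsPiecewiseSmoothBoundary.ae_eq_iUnion_image_coneMap (hγ : IsPiecewiseSmoothBoundary S γ)
    (hclosed : IsClosed S) (hbdd : Bornology.IsBounded S) (hstar : StarConvex ℝ (0 : Plane) S) :
    S =ᵐ[volume] ⋃ i, coneMap (γ i) '' transverseDomain (γ i) := by
  refine EventuallyLE.antisymm (ae_le_set.2 ?_) (LE.le.eventuallyLE ?_)
  · let C : Fin n → Set Plane := fun i =>
      {p ∈ coneDomain | cross (γ i (p 1)) (velocity (γ i) (p 1)) = 0}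
    have hC : ∀ i, volume (coneMap (γ i) '' C i) = 0 := fun i =>
      addHaar_image_eq_zero_of_det_fderivWithin_eq_zero volume
        (fun p hp => (hγ.smooth i).hasFDerivWithinAt_coneMap hp.1)
        (fun p hp => by rw [det_columnMap, cross_smul_right, hp.2, mul_zero])
    -- The exceptional set: the origin, the critical values, and the lines through the end points of
    -- the arcs, where no two-sided derivative is given.
    have hnull : volume ({0} ∪ ⋃ i, (coneMap (γ i) '' C i ∪ (range fun t : ℝ => t • γ i 0) ∪
        range fun t : ℝ => t • γ i 1)) = 0 := by
      refine measure_union_null (measure_singleton 0) (measure_iUnion_null fun i => ?_)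
      exact measure_union_null (measure_union_null (hC i) (volume_range_smul _))
        (volume_range_smul _)
    refine measure_mono_null ?_ hnull
    rintro x ⟨hxS, hx⟩
    by_cases hx0 : x = 0
    · exact Or.inl hx0
    obtain ⟨s, hs, hsx⟩ := exists_one_le_smul_mem_frontier hclosed hbdd hxS hx0
    have hs0 : 0 < s := by linarith
    rw [← hγ.cover] at hsx
    obtain ⟨i, u, hu, hux⟩ := mem_iUnion.1 hsx
    have e : s⁻¹ • γ i u = x := by rw [hux, inv_smul_smul₀ hs0.ne']
    refine Or.inr (mem_iUnion.2 ⟨i, ?_⟩)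
    rcases eq_or_lt_of_le hu.1 with h0 | h0
    · exact Or.inl (Or.inr ⟨s⁻¹, by rw [← e, ← h0]⟩)
    rcases eq_or_lt_of_le hu.2 with h1 | h1
    · exact Or.inr ⟨s⁻¹, by rw [← e, h1]⟩
    have hd : (!₂[s⁻¹, u] : Plane) ∈ coneDomain := by
      refine ⟨⟨?_, ?_⟩, ⟨?_, ?_⟩⟩
      · simpa using hs0
      · simpa using inv_le_one_of_one_le₀ hs
      · simpa using h0
      · simpa using h1
    have hex : coneMap (γ i) !₂[s⁻¹, u] = x := by simpa [coneMap] using e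
    refine Or.inl (Or.inl ⟨_, ⟨hd, ?_⟩, hex⟩)
    by_contra hne
    refine hx (mem_iUnion.2 ⟨i, _, ⟨hd, ?_⟩, hex⟩)
    exact lt_of_le_of_ne (hγ.cross_nonneg hclosed hstar i hd.2) (Ne.symm hne)
  · refine iUnion_subset fun i => ?_
    rintro _ ⟨p, hp, rfl⟩
    exact hγ.coneMap_mem hclosed hstar i (Ioc_subset_Icc_self hp.1.1)
      (Ioo_subset_Icc_self hp.1.2)

end boundary

/-! ### Integration over the cones -/

/-- Fubini's theorem over the parameters of a cone. -/
theorem setIntegral_coneDomain {f : ℝ → ℝ → ℝ}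
    (hf : ContinuousOn (fun z : ℝ × ℝ => f z.1 z.2) (Icc 0 1 ×ˢ Icc 0 1)) :
    ∫ p in coneDomain, f (p 0) (p 1) = ∫ u in (0 : ℝ)..1, ∫ t in (0 : ℝ)..1, f t u := by
  let e : Plane ≃ᵐ ℝ × ℝ :=
    (MeasurableEquiv.toLp 2 (Fin 2 → ℝ)).symm.trans MeasurableEquiv.finTwoArrow
  have he : MeasurePreserving e volume volume :=
    (EuclideanSpace.volume_preserving_symm_measurableEquiv_toLp (Fin 2)).trans
      (volume_preserving_finTwoArrow ℝ)
  have h1 := he.setIntegral_preimage_emb e.measurableEmbedding (fun z : ℝ × ℝ => f z.1 z.2)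
    (Ioc 0 1 ×ˢ Ioo 0 1)
  have hint : IntegrableOn (fun z : ℝ × ℝ => f z.1 z.2) (Ioc 0 1 ×ˢ Ioo 0 1) :=
    (hf.integrableOn_compact (isCompact_Icc.prod isCompact_Icc)).mono_set
      (prod_mono Ioc_subset_Icc_self Ioo_subset_Icc_self)
  have h2 : ∫ z in Ioc (0 : ℝ) 1 ×ˢ Ioo (0 : ℝ) 1, f z.1 z.2 =
      ∫ u in Ioo (0 : ℝ) 1, ∫ t in Ioc (0 : ℝ) 1, f t u := by
    rw [Measure.volume_eq_prod, ← setIntegral_prod_swap]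
    exact setIntegral_prod (fun z : ℝ × ℝ => f z.2 z.1) hint.swap
  simp only [intervalIntegral.integral_of_le zero_le_one, integral_Ioc_eq_integral_Ioo (μ := volume)
    (f := fun u => ∫ t in Ioc 0 1, f t u)]
  exact h1.trans h2

/-- Change of variables on the part of the plane swept out by the radii to one arc. -/
theorem setIntegral_image_coneMap {γ : ℝ → Plane} (h : IsSmoothArc γ)
    (hinj : InjOn (coneMap γ) (transverseDomain γ))
    (hpos : ∀ u ∈ Ioo (0 : ℝ) 1, 0 ≤ cross (γ u) (velocity γ u)) {ρ : Plane → ℝ}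
    (hρ : Continuous ρ) :
    ∫ r in coneMap γ '' transverseDomain γ, ρ r =
      ∫ u in (0 : ℝ)..1, dilationIntegral ρ (γ u) * cross (γ u) (velocity γ u) := by
  have hγc := h.contDiffOn.continuousOn
  have hcr := hγc.cross h.continuousOn_velocity
  have hs : MapsTo Prod.snd (Icc (0 : ℝ) 1 ×ˢ Icc (0 : ℝ) 1) (Icc (0 : ℝ) 1) := fun z hz => hz.2
  have hF : ContinuousOn (fun z : ℝ × ℝ =>
      z.1 * ρ (z.1 • γ z.2) * cross (γ z.2) (velocity γ z.2)) (Icc 0 1 ×ˢ Icc 0 1) :=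
    (continuousOn_fst.mul (hρ.comp_continuousOn
      (continuousOn_fst.smul (hγc.comp continuousOn_snd hs)))).mul (hcr.comp continuousOn_snd hs)
  rw [integral_image_eq_integral_abs_det_fderiv_smul volume h.measurableSet_transverseDomain
    (fun p hp => h.hasFDerivWithinAt_coneMap hp.1) hinj]
  calc _ = ∫ p in transverseDomain γ,
        p 0 * ρ (p 0 • γ (p 1)) * cross (γ (p 1)) (velocity γ (p 1)) := by
        refine setIntegral_congr_fun h.measurableSet_transverseDomain fun p hp => ?_
        simp only [det_columnMap, cross_smul_right, coneMap, smul_eq_mul]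
        rw [abs_of_pos (mul_pos hp.1.1.1 hp.2)]
        ring
    _ = ∫ p in coneDomain,
        p 0 * ρ (p 0 • γ (p 1)) * cross (γ (p 1)) (velocity γ (p 1)) := by
        -- Off the transverse part the cross product is zero, so the integrand vanishes there.
        refine (setIntegral_eq_of_subset_of_forall_sdiff_eq_zero measurableSet_coneDomain
          (fun p hp => hp.1) fun p hp => ?_).symm
        have h0 : cross (γ (p 1)) (velocity γ (p 1)) = 0 :=
          le_antisymm (not_lt.1 fun hlt => hp.2 ⟨hp.1, hlt⟩) (hpos _ hp.1.2)
        rw [h0, mul_zero]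
    _ = _ := by
        rw [setIntegral_coneDomain
          (f := fun t u => t * ρ (t • γ u) * cross (γ u) (velocity γ u)) hF]
        simp only [intervalIntegral.integral_mul_const, dilationIntegral]

theorem continuous_dilationIntegral {ρ : Plane → ℝ} (hρ : Continuous ρ) :
    Continuous (dilationIntegral ρ) := by
  unfold dilationIntegral
  apply intervalIntegral.continuous_parametric_intervalIntegral_of_continuous'
  fun_prop

theorem dilationIntegral_congr {S : Set Plane} (hstar : StarConvex ℝ (0 : Plane) S)
    {ρ σ : Plane → ℝ} (h : EqOn ρ σ S) {r : Plane} (hr : r ∈ S) :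
    dilationIntegral ρ r = dilationIntegral σ r := by
  refine intervalIntegral.integral_congr fun t ht => ?_
  rw [uIcc_of_le zero_le_one] at ht
  simp only [h (hstar.smul_mem hr ht.1 ht.2)]

theorem mainTheorem2 (S : Set Plane) (hclosed : IsClosed S) (hbdd : Bornology.IsBounded S)
    (h0 : (0 : Plane) ∈ S) (hstar : StarConvex ℝ (0 : Plane) S)
    {n : ℕ} (γ : Fin n → ℝ → Plane) (hγ : IsPiecewiseSmoothBoundary S γ)
    (ρ : Plane → ℝ) (hρ : ContDiffOn ℝ 1 ρ S) :
    IntegrableOn ρ S volume ∧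
    (∀ r ∈ frontier S, IntervalIntegrable (fun t : ℝ => t * ρ (t • r)) volume 0 1) ∧
    (∀ i, IntervalIntegrable
      (arcIntegrand (fun r τ => dilationIntegral ρ r * cross r τ) (γ i)) volume 0 1) ∧
    ∫ r in S, ρ r = boundaryIntegral γ (fun r τ => dilationIntegral ρ r * cross r τ) := by
  -- Tietze extension: `σ` is continuous on the whole plane and agrees with `ρ` on `S`. By
  -- star-shapedness the dilation integrals at points of `S` see only values on `S`.
  obtain ⟨σ, hσ⟩ := ContinuousMap.exists_restrict_eq hclosed
    ⟨S.domRestrict ρ, hρ.continuousOn.domRestrict⟩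
  have hρσ : EqOn ρ σ S := fun x hx => (DFunLike.congr_fun hσ ⟨x, hx⟩).symm
  have hScompact : IsCompact S := Metric.isCompact_of_isClosed_isBounded hclosed hbdd
  have hint : IntegrableOn ρ S volume := hρ.continuousOn.integrableOn_compact hScompact
  have hγS : ∀ i, ∀ u ∈ Icc (0 : ℝ) 1, γ i u ∈ S := fun i u hu =>
    hclosed.frontier_subset (hγ.mem_frontier i hu)
  have harc : ∀ i, EqOn (arcIntegrand (fun r τ => dilationIntegral ρ r * cross r τ) (γ i))
      (fun u => dilationIntegral σ (γ i u) * cross (γ i u) (velocity (γ i) u)) (Icc 0 1) := by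
    intro i u hu
    rw [arcIntegrand_dilation_eq (hγ.smooth i) _ hu,
      dilationIntegral_congr hstar hρσ (hγS i u hu)]
  refine ⟨hint, fun r hr => ?_, fun i => ?_, ?_⟩
  · apply ContinuousOn.intervalIntegrable_of_Icc zero_le_one
    have hcont : Continuous fun t : ℝ => t * σ (t • r) := by fun_prop
    refine hcont.continuousOn.congr fun t ht => ?_
    simp only [hρσ (hstar.smul_mem (hclosed.frontier_subset hr) ht.1 ht.2)]
  · apply ContinuousOn.intervalIntegrable_of_Icc zero_le_one
    have hc := (hγ.smooth i).contDiffOn.continuousOn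
    exact (((continuous_dilationIntegral σ.continuous).comp_continuousOn hc).mul
      (hc.cross (hγ.smooth i).continuousOn_velocity)).congr (harc i)
  · have hae := hγ.ae_eq_iUnion_image_coneMap hclosed hbdd hstar
    have hinj : ∀ i, InjOn (coneMap (γ i)) (transverseDomain (γ i)) := fun i p hp q hq h =>
      (hγ.coneMap_injective hclosed hstar hp hq h).2
    have hσint : IntegrableOn σ S volume := σ.continuous.continuousOn.integrableOn_compact hScompact
    rw [setIntegral_congr_fun hclosed.measurableSet hρσ, setIntegral_congr_set hae,
      integral_iUnion_fintype, boundaryIntegral]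
    · refine Finset.sum_congr rfl fun i _ => ?_
      rw [setIntegral_image_coneMap (hγ.smooth i) (hinj i)
        (fun u hu => hγ.cross_nonneg hclosed hstar i hu) σ.continuous]
      refine intervalIntegral.integral_congr fun u hu => ?_
      rw [uIcc_of_le zero_le_one] at hu
      exact (harc i hu).symm
    · exact fun i => measurable_image_of_fderivWithin
        (hγ.smooth i).measurableSet_transverseDomain
        (fun p hp => (hγ.smooth i).hasFDerivWithinAt_coneMap hp.1) (hinj i)
    · intro i j hij
      refine Set.disjoint_left.2 ?_
      rintro _ ⟨p, hp, rfl⟩ ⟨q, hq, h⟩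
      exact hij (hγ.coneMap_injective hclosed hstar hp hq h.symm).1
    · exact fun i => (hσint.congr_set_ae hae.symm).mono_set
        (subset_iUnion (fun i => coneMap (γ i) '' transverseDomain (γ i)) i)
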